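/- Let $\mathcal C$ be a finite set of finite connected graphs, each of them \emph{solid}, i.e. every induced 2-connected subgraph (at least three vertices, connected, and connected after deleting any one vertex) is complete. A graph omits $\mathcal C$ if none of its subgraphs, induced or not, is isomorphic to a member of $\mathcal C$; $\mathcal G_{\mathcal C}$ is the class of countable graphs omitting $\mathcal C$. Let $\mathcal E_{\mathcal C}$ be the class of all $G\in\mathcal G_{\mathcal C}$ that are existentially complete: whenever $G$ is an induced subgraph of some $H\in\mathcal G_{\mathcal C}$, every existential first-order statement with parameters from $G$ that is true in $H$ is true in $G$. The type of a finite tuple of vertices of a graph is the set of existential formulas it satisfies. Let $G\in\mathcal E_{\mathcal C}$ be $\aleph_0$-saturated: for every $n$-tuple $\bar a$ in $G$ and every $(n+1)$-tuple $\bar b$ in some $H\in\mathcal E_{\mathcal C}$ whose first $n$ entries have in $H$ the type that $\bar a$ has in $G$, there is a vertex $v$ of $G$ such that $(\bar a,v)$ has in $G$ the type that $\bar b$ has in $H$. For a set $X$ of vertices of $G$ let $\mathrm{acl}(X)$ be the set of vertices $x$ for which there is an existential formula $\varphi(\cdot,\bar a)$ with parameters $\bar a$ in $X$ that holds of $x$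 and of only finitely many vertices of $G$. For a finite (not necessarily induced) subgraph $H$ of $G$ and a set $A$ of vertices of $H$, say that $H$ is \emph{free} over $A$ if there is an infinite sequence of injective graph homomorphisms $f_i:H\to G$ fixing $A$ pointwise with $f_i(H)\cap f_j(H)=A$ (as vertex sets) for all $i\ne j$. Let $\mathrm{cl}(A;H)$ be the union of $A$ with all sets $B$ of vertices of $H$ that are minimal such that $H$ is free over $A\cup B$. For a collection $\mathcal F$ of pairs $(A,H)$, where $H$ is a finite graph and $A$ a set of its vertices, let $\mathrm{cl}(X;\mathcal F)$ be the union of $X$ with all sets $\mathrm{cl}(A;H)$ where $A\subseteq X$, $H$ is a subgraph of $G$ and $(A,H)$ is isomorphic to a pair in $\mathcal F$. Call $\mathcal F$ a \emph{base} for $\mathrm{acl}$ if for all sets $X$ of vertices of $G$: $X=\mathrm{cl}(X;\mathcal F)$ if and only if $X=\mathrm{acl}(X)$. Let $\mathcal F$ be the collection of all pairs $(\{a\},H)$ for which, for some $C\in\mathcal C$, $H$ is a proper subgraph of $C$, $a$ is a vertex of $H$, and $H-\{a\}$ is a connected component of $C-\{a\}$. Then $\mathcal F$ is a base for $\mathrm{acl}$,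 and so is the subcollection of those pairs in which $H$ is an induced subgraph of $C$. In particular, for every set $X$ of vertices of $G$, $$\mathrm{acl}(X)=\bigcup_{a\in X}\mathrm{acl}(\{a\}).$$ -/

import Mathlib

open FirstOrder

universe u

namespace ForbiddenSubgraphs

/-- A finite graph (every finite graph is isomorphic to one on some `Fin n`). -/
structure FinGraph where
  order : ℕ
  graph : SimpleGraph (Fin order)

/-- `G` omits `𝒞`: no (not necessarily induced) subgraph of `G` is isomorphic to a member of `𝒞`. -/
def Omits (𝒞 : Set FinGraph) {V : Type u} (G : SimpleGraph V) : Prop :=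
  ∀ C ∈ 𝒞, C.graph.Free G

/-- `G` is a countable graph omitting `𝒞`. -/
def MemG (𝒞 : Set FinGraph) {V : Type u} (G : SimpleGraph V) : Prop :=
  Countable V ∧ Omits 𝒞 G

/-- Truth of a first-order formula of the language of graphs at a tuple of vertices of `G`. -/
def Sat {V : Type u} (G : SimpleGraph V) {n : ℕ} (φ : Language.graph.Formula (Fin n))
    (a : Fin n → V) : Prop :=
  letI := G.structure
  φ.Realize a

/-- `G`, identified with an induced subgraph of `H` by `f`, is existentially complete in `H`:
every existential statement with parameters from `G` that is true in `H` is true in `G`. -/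
def ExComplete {V W : Type u} {G : SimpleGraph V} {H : SimpleGraph W} (f : G ↪g H) : Prop :=
  ∀ (n : ℕ) (φ : Language.graph.Formula (Fin n)) (a : Fin n → V),
    φ.IsExistential → Sat H φ (f ∘ a) → Sat G φ a

/-- `G` is existentially complete for the class of countable graphs omitting `𝒞`. -/
def MemE (𝒞 : Set FinGraph) {V : Type u} (G : SimpleGraph V) : Prop :=
  MemG 𝒞 G ∧
    ∀ (W : Type u) (H : SimpleGraph W), MemG 𝒞 H → ∀ f : G ↪g H, ExComplete f

/-- The existential type of a tuple. -/
def exType {V : Type u} (G : SimpleGraph V) {n : ℕ} (a : Fin n → V) :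
    Set (Language.graph.Formula (Fin n)) :=
  {φ | φ.IsExistential ∧ Sat G φ a}

/-- `ℵ₀`-saturation of `G` among existentially complete graphs: every existential `(n+1)`-type
realized in some existentially complete graph, whose restriction to the first `n` variables is
the type of `a` in `G`, is realized in `G` by a tuple `(a, v)`. -/
def Saturated (𝒞 : Set FinGraph) {V : Type u} (G : SimpleGraph V) : Prop :=
  ∀ (n : ℕ) (a : Fin n → V) (W : Type u) (H : SimpleGraph W), MemE 𝒞 H →
    ∀ b : Fin (n + 1) → W, exType H (b ∘ Fin.castSucc) = exType G a →
      ∃ v : V, exType G (Fin.snoc a v : Fin (n + 1) → V) = exType H b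

/-- Algebraic closure: the vertices lying in a finite set defined by an existential formula with
parameters from `A`. -/
def acl {V : Type u} (G : SimpleGraph V) (A : Set V) : Set V :=
  {x | ∃ (n : ℕ) (φ : Language.graph.Formula (Fin (n + 1))) (a : Fin n → V),
    φ.IsExistential ∧ (∀ i, a i ∈ A) ∧
    {y | Sat G φ (Fin.snoc a y : Fin (n + 1) → V)}.Finite ∧
    Sat G φ (Fin.snoc a x : Fin (n + 1) → V)}

/-- For a subgraph `H` of `G` and `A ⊆ H`: `H` is free over `A` if there is an infinite family
of copies of `H` in `G` over `A`, any two of which intersect exactly in `A`. Copies are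
not necessarily induced. In particular `H` is free over its whole vertex set. -/
def FreeOver {V : Type u} (G : SimpleGraph V) (A : Set V) (H : G.Subgraph) : Prop :=
  ∃ f : ℕ → H.coe.Copy G,
    (∀ i, ∀ x : H.verts, (x : V) ∈ A → f i x = x) ∧
    ∀ i j, i ≠ j → Set.range (f i) ∩ Set.range (f j) = A

/-- `cl(A; H)`: the union of `A` with all `B ⊆ H` minimal such that `H` is free over `A ∪ B`. -/
def cl {V : Type u} (G : SimpleGraph V) (A : Set V) (H : G.Subgraph) : Set V :=
  A ∪ ⋃₀ {B | Minimal (fun B' => B' ⊆ H.verts ∧ FreeOver G (A ∪ B') H) B}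

/-- A pair `(A, H)` with `H` a finite graph and `A` a set of vertices of `H`. -/
structure GraphPair where
  order : ℕ
  graph : SimpleGraph (Fin order)
  base : Set (Fin order)

/-- For a subgraph `H` of `G`, the pair `(A, H)` is isomorphic to the pair `p`. -/
def IsoPair {V : Type u} {G : SimpleGraph V} (A : Set V) (H : G.Subgraph) (p : GraphPair) : Prop :=
  A ⊆ H.verts ∧ ∃ e : H.coe ≃g p.graph, ∀ x : H.verts, (x : V) ∈ A ↔ e x ∈ p.base

/-- `cl(X; F)`: the union of `X` with all `cl(A; H)` for which `A ⊆ X`, `H` is a subgraph of `G`,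
and `(A, H)` is isomorphic to a pair in `F`. -/
def clFam {V : Type u} (G : SimpleGraph V) (F : Set GraphPair) (X : Set V) : Set V :=
  X ∪ {y | ∃ (A : Set V) (H : G.Subgraph), A ⊆ X ∧ (∃ p ∈ F, IsoPair A H p) ∧ y ∈ cl G A H}

/-- `F` is a base for `acl` in `G`. -/
def IsBase {V : Type u} (G : SimpleGraph V) (F : Set GraphPair) : Prop :=
  ∀ X : Set V, X = clFam G F X ↔ X = acl G X

/-- A graph with at least three vertices that is connected and stays so on deletion of any
one vertex. -/
def TwoConnected {V : Type u} (G : SimpleGraph V) : Prop :=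
  3 ≤ ENat.card V ∧ G.Connected ∧ ∀ v : V, (G.induce {v}ᶜ).Connected

/-- Every 2-connected induced subgraph is complete. -/
def Solid {V : Type u} (H : SimpleGraph V) : Prop :=
  ∀ S : Set V, TwoConnected (H.induce S) → H.induce S = ⊤

/-- `a` is a vertex of the proper subgraph `H` of `C`, and `H - {a}` is a connected component
of `C - {a}`. -/
def IsBranch {V : Type u} (C : SimpleGraph V) (a : V) (H : C.Subgraph) : Prop :=
  H ≠ ⊤ ∧ a ∈ H.verts ∧
    ∃ K : (C.induce {a}ᶜ).ConnectedComponent,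
      H.deleteVerts {a} = (⊤ : C.Subgraph).induce (Subtype.val '' K.supp)

/-- The pairs `({a}, H)` for which `H` is a proper subgraph of some `C ∈ 𝒞`, `a ∈ H`, and
`H - {a}` is a connected component of `C - {a}`. -/
def branchPairs (𝒞 : Set FinGraph) : Set GraphPair :=
  {p | ∃ C ∈ 𝒞, ∃ (a : Fin C.order) (H : C.graph.Subgraph),
    IsBranch C.graph a H ∧ IsoPair {a} H p}

/-- The pairs `({a}, H)` as in `branchPairs` in which `H` is moreover an induced subgraph of
`C`. -/
def inducedBranchPairs (𝒞 : Set FinGraph) : Set GraphPair :=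
  {p | ∃ C ∈ 𝒞, ∃ (a : Fin C.order) (H : C.graph.Subgraph),
    IsBranch C.graph a H ∧ H.IsInduced ∧ IsoPair {a} H p}

end ForbiddenSubgraphs

/-!
By an argument in the style of Neumann's lemma, a finite part of `G` can be embedded in `G` over `X`
in such a way that only elements of `acl X` are mapped into a given finite set. If `X = acl X`, this
shows that a finite subgraph that is free over `A ∪ B`, with `A ⊆ X`, is also free over
`A ∪ (B ∩ X)`. Hence a minimal such `B` is contained in `X`, and `X` is closed under `cl`.

Conversely, let `X` be closed with respect to the pairs of induced branches, and consider the free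
amalgam of two copies of `G` over `X`. Suppose that it contains a copy of some `C ∈ 𝒞`. Since `C` is
solid, the neighbours of `a` in a branch at `a` form, together with `a`, a clique, so they lie in
one copy of `G`; by induction, the smaller branches at these neighbours can be moved into that copy
of `G`, and then so is the whole branch at `a`. If this is not the desired copy, then `a ∈ X`, and
the branch can be moved across because it is free over a subset of `X`. In the end `C` is contained
in `G`, a contradiction. So the amalgam omits `𝒞`, and existential completeness lets every finite
part of it embed in `G` over the first copy. An element of `acl X` outside `X` would give an element
of the second copy that is mapped to a vertex of the first copy which is already taken.

Finally, `⋃ a ∈ X, acl {a}` is closed with respect to the pairs of induced branches, because their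
bases are singletons and `acl` is idempotent. Idempotence is again finite combinatorics: the
permutations induced on a finite invariant set by embeddings over `X` can be inverted.
-/

namespace ForbiddenSubgraphs

/-! ### Embeddings of finite pieces -/

section Embedding

variable {V W U : Type*} {G : SimpleGraph V} {H : SimpleGraph W} {S T X : Set V}

/-- The restriction of `f` to `S` is an embedding of the subgraph induced on `S`. The values of
`f` outside `S` are irrelevant; total functions make it possible to compose and to enlarge `S`
without coercions. -/
structure IsEmbeddingOn (G : SimpleGraph V) (H : SimpleGraph W) (S : Set V) (f : V → W) :
    Prop where
  injOn : S.InjOn f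
  adj_iff : ∀ u ∈ S, ∀ v ∈ S, (H.Adj (f u) (f v) ↔ G.Adj u v)

theorem IsEmbeddingOn.mono {f : V → W} (hf : IsEmbeddingOn G H T f) (h : S ⊆ T) :
    IsEmbeddingOn G H S f :=
  ⟨hf.injOn.mono h, fun u hu v hv => hf.adj_iff u (h hu) v (h hv)⟩

theorem IsEmbeddingOn.comp {K : SimpleGraph U} {f : V → W} {g : W → U}
    (hg : IsEmbeddingOn H K (f '' S) g) (hf : IsEmbeddingOn G H S f) :
    IsEmbeddingOn G K S (g ∘ f) :=
  ⟨hg.injOn.comp hf.injOn (Set.mapsTo_image f S), fun u hu v hv =>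
    (hg.adj_iff _ ⟨u, hu, rfl⟩ _ ⟨v, hv, rfl⟩).trans (hf.adj_iff u hu v hv)⟩

theorem isEmbeddingOn_embedding (f : G ↪g H) (S : Set V) : IsEmbeddingOn G H S f :=
  ⟨f.injective.injOn, fun _ _ _ _ => f.map_adj_iff⟩

theorem exists_isEmbeddingOn_of_induce [Nonempty W] (f : G.induce S ↪g H) :
    ∃ g : V → W, IsEmbeddingOn G H S g ∧ ∀ v : S, g v = f v := by
  obtain ⟨w⟩ := ‹Nonempty W›
  have hg : ∀ v : S, Function.extend Subtype.val f (fun _ => w) v = f v :=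
    fun v => Subtype.val_injective.extend_apply f _ v
  refine ⟨_, ⟨fun u hu v hv huv => ?_, fun u hu v hv => ?_⟩, hg⟩
  · rw [hg ⟨u, hu⟩, hg ⟨v, hv⟩] at huv
    exact congrArg Subtype.val (f.injective huv)
  · rw [hg ⟨u, hu⟩, hg ⟨v, hv⟩]
    exact f.map_adj_iff

/-- The restriction of `f` to `S` is an embedding that fixes the elements of `X`. -/
structure IsEmbeddingOver (G : SimpleGraph V) (X S : Set V) (f : V → V) : Prop
    extends IsEmbeddingOn G G S f where
  fix : ∀ v ∈ S, v ∈ X → f v = v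

theorem isEmbeddingOver_id (G : SimpleGraph V) (X S : Set V) : IsEmbeddingOver G X S id :=
  ⟨⟨Set.injOn_id S, fun _ _ _ _ => Iff.rfl⟩, fun _ _ _ => rfl⟩

theorem IsEmbeddingOver.mono {f : V → V} (hf : IsEmbeddingOver G X T f) (h : S ⊆ T) :
    IsEmbeddingOver G X S f :=
  ⟨hf.toIsEmbeddingOn.mono h, fun v hv => hf.fix v (h hv)⟩

theorem IsEmbeddingOver.comp {f g : V → V} (hg : IsEmbeddingOver G X (f '' S) g)
    (hf : IsEmbeddingOver G X S f) : IsEmbeddingOver G X S (g ∘ f) := by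
  refine ⟨hg.toIsEmbeddingOn.comp hf.toIsEmbeddingOn, fun v hv hvX => ?_⟩
  have hfv := hf.fix v hv hvX
  rw [Function.comp_apply, hg.fix _ ⟨v, hv, rfl⟩ (hfv.symm ▸ hvX), hfv]

end Embedding

/-! ### Existential formulas -/

section Formula

open FirstOrder.Language BoundedFormula

theorem isQF_iInf {L : Language} {α : Type*} {n : ℕ} {β : Type*} [Finite β]
    {f : β → L.BoundedFormula α n} (h : ∀ b, (f b).IsQF) : (iInf f).IsQF := by
  let := Fintype.ofFinite β
  change IsQF (List.foldr _ _ (List.map f (Finset.univ : Finset β).toList))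
  generalize (Finset.univ : Finset β).toList = l
  induction l with
  | nil => exact IsQF.top
  | cons b l ih => exact (h b).inf ih

theorem isExistential_exs {L : Language} {α : Type*} {n : ℕ} {φ : L.BoundedFormula α n}
    (h : φ.IsExistential) : φ.exs.IsExistential := by
  induction n with
  | zero => exact h
  | succ n ih => exact ih h.ex

theorem exists_isQF_exs_eq {L : Language} {α : Type*} {n : ℕ} {φ : L.BoundedFormula α n}
    (h : φ.IsExistential) : ∃ (k : ℕ) (ψ : L.BoundedFormula α k), ψ.IsQF ∧ φ.exs = ψ.exs := by
  induction h with
  | of_isQF h => exact ⟨_, _, h, rfl⟩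
  | ex _ ih => exact ih

theorem graph_term_eq_var {α : Type*} (t : Language.graph.Term α) : ∃ i, t = Term.var i := by
  cases t with
  | var i => exact ⟨i, rfl⟩
  | func f _ => exact f.elim

theorem IsEmbeddingOn.realize_iff {V W : Type*} {G : SimpleGraph V} {H : SimpleGraph W}
    {α : Type*} {n : ℕ} {φ : Language.graph.BoundedFormula α n} (hφ : φ.IsQF) {f : V → W}
    {v : α → V} {x : Fin n → V} (hf : IsEmbeddingOn G H (Set.range (Sum.elim v x)) f) :
    (letI := H.structure; φ.Realize (f ∘ v) (f ∘ x)) ↔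
      (letI := G.structure; φ.Realize v x) := by
  have helim : Sum.elim (f ∘ v) (f ∘ x) = f ∘ Sum.elim v x := (Sum.comp_elim f v x).symm
  induction hφ with
  | falsum => exact Iff.rfl
  | imp _ _ h₁ h₂ => exact imp_congr h₁ h₂
  | of_isAtomic hA =>
    cases hA with
    | equal t₁ t₂ =>
      obtain ⟨i, rfl⟩ := graph_term_eq_var t₁
      obtain ⟨j, rfl⟩ := graph_term_eq_var t₂
      change Sum.elim (f ∘ v) (f ∘ x) i = Sum.elim (f ∘ v) (f ∘ x) j ↔
        Sum.elim v x i = Sum.elim v x j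
      rw [helim]
      exact hf.injOn.eq_iff ⟨i, rfl⟩ ⟨j, rfl⟩
    | rel R ts =>
      choose i hi using fun a => graph_term_eq_var (ts a)
      obtain rfl : ts = fun a => Term.var (i a) := funext hi
      cases R
      change H.Adj (Sum.elim (f ∘ v) (f ∘ x) (i 0)) (Sum.elim (f ∘ v) (f ∘ x) (i 1)) ↔
        G.Adj (Sum.elim v x (i 0)) (Sum.elim v x (i 1))
      rw [helim]
      exact hf.adj_iff _ ⟨i 0, rfl⟩ _ ⟨i 1, rfl⟩

theorem exists_finite_of_sat {n : ℕ} {φ : Language.graph.Formula (Fin n)} (hφ : φ.IsExistential)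
    {V : Type u} {G : SimpleGraph V} {a : Fin n → V} (h : Sat G φ a) :
    ∃ S : Set V, S.Finite ∧ Set.range a ⊆ S ∧
      ∀ (W : Type u) (H : SimpleGraph W) (f : V → W), IsEmbeddingOn G H S f → Sat H φ (f ∘ a) := by
  obtain ⟨k, ψ, hψ, hexs⟩ := exists_isQF_exs_eq hφ
  obtain rfl : φ = ψ.exs := hexs
  let := G.structure
  obtain ⟨w, hw⟩ := BoundedFormula.realize_exs.1 h
  refine ⟨Set.range (Sum.elim a w), Set.finite_range _, ?_, fun W H f hf => ?_⟩
  · rw [Set.Sum.elim_range]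
    exact Set.subset_union_left
  · let := H.structure
    exact BoundedFormula.realize_exs.2 ⟨f ∘ w, (hf.realize_iff hψ).2 hw⟩

open Classical in
/-- The formula `φ` or its negation, according to the truth value of `P`. -/
noncomputable def literal {L : Language} {α : Type*} {n : ℕ} (P : Prop)
    (φ : L.BoundedFormula α n) : L.BoundedFormula α n :=
  if P then φ else φ.not

theorem realize_literal {L : Language} {M : Type*} [L.Structure M] {α : Type*} {n : ℕ} {P : Prop}
    {φ : L.BoundedFormula α n} {v : α → M} {x : Fin n → M} :
    (literal P φ).Realize v x ↔ (φ.Realize v x ↔ P) := by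
  by_cases hP : P <;> simp [literal, hP]

theorem isQF_literal {L : Language} {α : Type*} {n : ℕ} (P : Prop) {φ : L.BoundedFormula α n}
    (hφ : φ.IsQF) : (literal P φ).IsQF := by
  unfold literal
  split_ifs
  exacts [hφ, hφ.not]

/-- The formula in the variables `v₁, …, vₙ` and `w₁, …, wₖ` saying that `w` is an embedding of
`K` and that `w ∘ a = v`. -/
noncomputable def diagram {n k : ℕ} (K : SimpleGraph (Fin k)) (a : Fin n → Fin k) :
    Language.graph.BoundedFormula (Fin n) k :=
  (iInf fun p : Fin k × Fin k =>
    literal (p.1 = p.2) ((Term.var (.inr p.1)).bdEqual (Term.var (.inr p.2))) ⊓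
    literal (K.Adj p.1 p.2) (adj.boundedFormula₂ (Term.var (.inr p.1)) (Term.var (.inr p.2)))) ⊓
  iInf fun i : Fin n => (Term.var (.inr (a i))).bdEqual (Term.var (.inl i))

theorem isQF_diagram {n k : ℕ} (K : SimpleGraph (Fin k)) (a : Fin n → Fin k) :
    (diagram K a).IsQF :=
  (isQF_iInf fun _ => (isQF_literal _ (IsAtomic.equal _ _).isQF).inf
    (isQF_literal _ (IsAtomic.rel _ _).isQF)).inf (isQF_iInf fun _ => (IsAtomic.equal _ _).isQF)

theorem realize_diagram {n k : ℕ} {K : SimpleGraph (Fin k)} {a : Fin n → Fin k} {W : Type*}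
    {H : SimpleGraph W} {v : Fin n → W} {w : Fin k → W} :
    (letI := H.structure; (diagram K a).Realize v w) ↔
      ∃ f : K ↪g H, f = w ∧ f ∘ a = v := by
  let := H.structure
  have hadj : ∀ x y : W, Structure.RelMap adj ![x, y] ↔ H.Adj x y := fun _ _ => Iff.rfl
  simp only [diagram, realize_inf, realize_iInf, realize_literal, realize_bdEqual, realize_rel₂,
    Term.realize_var, Sum.elim_inl, Sum.elim_inr, hadj, Prod.forall]
  constructor
  · rintro ⟨hw, ha⟩
    exact ⟨⟨⟨w, fun i j h => (hw i j).1.1 h⟩, (hw _ _).2⟩, rfl, funext ha⟩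
  · rintro ⟨f, rfl, rfl⟩
    exact ⟨fun i j => ⟨f.injective.eq_iff, f.map_adj_iff⟩, fun i => rfl⟩

theorem exists_formula_of_finite {κ : Type*} [Finite κ] (K : SimpleGraph κ) {n : ℕ}
    (a : Fin n → κ) : ∃ φ : Language.graph.Formula (Fin n), φ.IsExistential ∧
      ∀ (W : Type u) (H : SimpleGraph W) (b : Fin n → W),
        Sat H φ b ↔ ∃ f : K ↪g H, f ∘ a = b := by
  obtain ⟨k, ⟨e⟩⟩ := Finite.exists_equiv_fin κ
  let iso : K ≃g K.map e.toEmbedding := .map e K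
  refine ⟨(diagram (K.map e.toEmbedding) (e ∘ a)).exs,
    isExistential_exs (isQF_diagram _ _).isExistential, fun W H b => ?_⟩
  let := H.structure
  refine BoundedFormula.realize_exs.trans ?_
  simp only [realize_diagram]
  constructor
  · rintro ⟨_, f, -, hf⟩
    exact ⟨f.comp iso.toEmbedding, hf⟩
  · rintro ⟨f, rfl⟩
    exact ⟨_, f.comp iso.symm.toEmbedding, rfl, funext fun i => by simp [iso]⟩

end Formula

section Acl

variable {V : Type u} {G : SimpleGraph V} {X S : Set V} {x : V}

theorem IsEmbeddingOver.comp_snoc {n : ℕ} {a : Fin n → V} {f : V → V} (ha : ∀ i, a i ∈ X)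
    (hf : IsEmbeddingOver G X S f) (hS : Set.range (Fin.snoc a x : Fin (n + 1) → V) ⊆ S) :
    f ∘ (Fin.snoc a x : Fin (n + 1) → V) = Fin.snoc a (f x) := by
  rw [Fin.comp_snoc]
  congr 1
  exact funext fun i => hf.fix _ (hS ⟨i.castSucc, Fin.snoc_castSucc ..⟩) (ha i)

theorem mem_acl_iff :
    x ∈ acl G X ↔ ∃ S : Set V, S.Finite ∧ x ∈ S ∧
      {y | ∃ f, IsEmbeddingOver G X S f ∧ f x = y}.Finite := by
  constructor
  · rintro ⟨n, φ, a, hφ, ha, hfin, hx⟩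
    obtain ⟨S, hS, haS, hsat⟩ := exists_finite_of_sat hφ hx
    refine ⟨S, hS, haS ⟨Fin.last n, Fin.snoc_last ..⟩, hfin.subset ?_⟩
    rintro _ ⟨f, hf, rfl⟩
    simpa only [hf.comp_snoc ha haS, Set.mem_ofPred_eq] using hsat V G f hf.toIsEmbeddingOn
  · rintro ⟨S, hS, hxS, hfin⟩
    have : Nonempty V := ⟨x⟩
    have := hS.to_subtype
    obtain ⟨n, ⟨e⟩⟩ := Finite.exists_equiv_fin {v : S // (v : V) ∈ X}
    let a : Fin n → V := fun i => (e.symm i).1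
    let b : Fin (n + 1) → S := Fin.snoc (fun i => (e.symm i).1) ⟨x, hxS⟩
    obtain ⟨φ, hφ, hsat⟩ := exists_formula_of_finite (G.induce S) b
    have hb : Subtype.val ∘ b = (Fin.snoc a x : Fin (n + 1) → V) := Fin.comp_snoc ..
    refine ⟨n, φ, a, hφ, fun i => (e.symm i).2, hfin.subset fun y hy => ?_,
      (hsat V G _).2 ⟨SimpleGraph.Embedding.induce S, hb⟩⟩
    obtain ⟨f, hfb⟩ := (hsat V G _).1 hy
    obtain ⟨g, hg, hgf⟩ := exists_isEmbeddingOn_of_induce f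
    have hgb : g ∘ (Fin.snoc a x : Fin (n + 1) → V) = Fin.snoc a y := by
      rw [← hfb, ← hb]
      exact funext fun i => hgf (b i)
    rw [Fin.comp_snoc, Fin.snoc_inj] at hgb
    refine ⟨g, ⟨hg, fun v hv hvX => ?_⟩, hgb.2⟩
    simpa [a] using congrFun hgb.1 (e ⟨⟨v, hv⟩, hvX⟩)

theorem acl_mono (G : SimpleGraph V) {X Y : Set V} (h : X ⊆ Y) : acl G X ⊆ acl G Y := by
  rintro x ⟨n, φ, a, hφ, ha, hfin, hx⟩
  exact ⟨n, φ, a, hφ, fun i => h (ha i), hfin, hx⟩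

theorem subset_acl (G : SimpleGraph V) (X : Set V) : X ⊆ acl G X := by
  refine fun x hx => mem_acl_iff.2 ⟨{x}, Set.finite_singleton x, rfl,
    (Set.finite_singleton x).subset ?_⟩
  rintro _ ⟨f, hf, rfl⟩
  exact hf.fix x rfl hx

theorem MemE.exists_isEmbeddingOn {𝒞 : Set FinGraph} [Nonempty V] (hG : MemE 𝒞 G) {W : Type u}
    {H : SimpleGraph W} (hH : MemG 𝒞 H) (f : G ↪g H) {T : Set W} (hT : T.Finite) :
    ∃ g : W → V, IsEmbeddingOn H G T g ∧ ∀ v, f v ∈ T → g (f v) = v := by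
  have := hT.to_subtype
  have := (hT.preimage f.injective.injOn).to_subtype
  obtain ⟨n, ⟨e⟩⟩ := Finite.exists_equiv_fin (f ⁻¹' T)
  let a : Fin n → T := fun i => ⟨f (e.symm i).1, (e.symm i).2⟩
  obtain ⟨φ, hφ, hsat⟩ := exists_formula_of_finite (H.induce T) a
  have hφH : Sat H φ (f ∘ fun i => (e.symm i).1) :=
    (hsat W H _).2 ⟨SimpleGraph.Embedding.induce T, rfl⟩
  obtain ⟨h, ha⟩ := (hsat V G _).1 (hG.2 W H hH f n φ _ hφ hφH)
  obtain ⟨g, hg, hgh⟩ := exists_isEmbeddingOn_of_induce h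
  refine ⟨g, hg, fun v hv => ?_⟩
  rw [hgh ⟨f v, hv⟩]
  simpa [a] using congrFun ha (e ⟨v, hv⟩)

end Acl

/-! ### Invariant sets -/

section Invariant

variable {V : Type u} {G : SimpleGraph V} {X S T Ω Θ : Set V} {x : V}

/-- A finite set mapped into itself by all embeddings over `X` of a suitable finite part of `G`. -/
def Invariant (G : SimpleGraph V) (X Ω : Set V) : Prop :=
  ∃ S : Set V, S.Finite ∧ Ω ⊆ S ∧ ∀ f, IsEmbeddingOver G X S f → Set.MapsTo f Ω Ω

theorem Invariant.finite (h : Invariant G X Ω) : Ω.Finite :=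
  let ⟨_, hS, hΩ, _⟩ := h
  hS.subset hΩ

theorem Invariant.union (hΩ : Invariant G X Ω) (hΘ : Invariant G X Θ) :
    Invariant G X (Ω ∪ Θ) := by
  obtain ⟨S, hS, hΩS, hΩ⟩ := hΩ
  obtain ⟨T, hT, hΘT, hΘ⟩ := hΘ
  exact ⟨S ∪ T, hS.union hT, Set.union_subset_union hΩS hΘT, fun f hf =>
    (hΩ f (hf.mono Set.subset_union_left)).union_union (hΘ f (hf.mono Set.subset_union_right))⟩

theorem Invariant.subset_acl (h : Invariant G X Ω) : Ω ⊆ acl G X := by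
  obtain ⟨S, hS, hΩS, hΩ⟩ := h
  refine fun x hx => mem_acl_iff.2 ⟨S, hS, hΩS hx, (hS.subset hΩS).subset ?_⟩
  rintro _ ⟨f, hf, rfl⟩
  exact hΩ f hf hx

theorem exists_invariant_of_mem_acl (hx : x ∈ acl G X) : ∃ Ω, Invariant G X Ω ∧ x ∈ Ω := by
  obtain ⟨S, hS, hxS, hfin⟩ := mem_acl_iff.1 hx
  have hconj : ∀ y ∈ {y | ∃ f, IsEmbeddingOver G X S f ∧ f x = y},
      ∃ f, IsEmbeddingOver G X S f ∧ f x = y := fun _ hy => hy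
  choose! f hf hfx using hconj
  refine ⟨{y | ∃ f, IsEmbeddingOver G X S f ∧ f x = y},
    ⟨_, hfin.biUnion fun y _ => hS.image (f y), fun y hy => ?_, ?_⟩,
    ⟨id, isEmbeddingOver_id G X S, rfl⟩⟩
  · exact Set.mem_biUnion hy ⟨x, hxS, hfx y hy⟩
  · intro g hg y hy
    refine ⟨g ∘ f y, (hg.mono (Set.subset_biUnion_of_mem (u := fun y => f y '' S) hy)).comp
      (hf y hy), congrArg g (hfx y hy)⟩

theorem exists_invariant_of_subset_acl (hT : T.Finite) (h : T ⊆ acl G X) :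
    ∃ Ω, Invariant G X Ω ∧ T ⊆ Ω := by
  induction T, hT using Set.Finite.induction_on with
  | empty =>
    exact ⟨∅, ⟨∅, Set.finite_empty, subset_rfl, fun f _ => Set.mapsTo_empty f _⟩, subset_rfl⟩
  | insert _ _ ih =>
    obtain ⟨Ω, hΩ, hTΩ⟩ := ih ((Set.subset_insert _ _).trans h)
    obtain ⟨Θ, hΘ, hx⟩ := exists_invariant_of_mem_acl (h (Set.mem_insert _ _))
    exact ⟨Θ ∪ Ω, hΘ.union hΩ, Set.insert_subset (.inl hx) (hTΩ.trans Set.subset_union_right)⟩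

end Invariant

/-! ### Hitting sets and Neumann's lemma -/

section HittingSet

variable {α : Type*} {D F : Set (Set α)} {T : Finset α}

/-- The finite set `T` meets every member of the family `D`. -/
def IsHittingSet (D : Set (Set α)) (T : Finset α) : Prop :=
  ∀ d ∈ D, ∃ v ∈ d, v ∈ T

theorem exists_finite_subfamily_of_isHittingSet (hD : ∀ d ∈ D, d.Finite) (n : ℕ) :
    ∃ F ⊆ D, F.Finite ∧ ∀ T : Finset α, T.card ≤ n → IsHittingSet F T → IsHittingSet D T := by
  classical
  obtain rfl | ⟨d, hd⟩ := D.eq_empty_or_nonempty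
  · exact ⟨∅, subset_rfl, Set.finite_empty, fun _ _ h => h⟩
  induction n generalizing D d with
  | zero =>
    refine ⟨{d}, by simpa, Set.finite_singleton d, fun T hT hF => ?_⟩
    obtain ⟨v, -, hv⟩ := hF d rfl
    simp [Finset.card_eq_zero.1 (Nat.le_zero.1 hT)] at hv
  | succ n ih =>
    have hsub : ∀ v, ∃ F ⊆ {d' ∈ D | v ∉ d'}, F.Finite ∧ ∀ T : Finset α, T.card ≤ n →
        IsHittingSet F T → IsHittingSet {d' ∈ D | v ∉ d'} T := fun v => by
      obtain h | ⟨d', hd'⟩ := {d' ∈ D | v ∉ d'}.eq_empty_or_nonempty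
      · exact ⟨∅, Set.empty_subset _, Set.finite_empty, fun T _ _ => by simp [h, IsHittingSet]⟩
      · exact ih (fun d'' h => hD d'' h.1) d' hd'
    choose F hFD hF hFT using hsub
    refine ⟨insert d (⋃ v ∈ d, F v), Set.insert_subset hd (Set.iUnion₂_subset fun v _ =>
      (hFD v).trans (Set.sep_subset _ _)), ((hD d hd).biUnion fun v _ => hF v).insert d, ?_⟩
    intro T hT hhit d' hd'
    obtain ⟨v, hvd, hvT⟩ := hhit d (Set.mem_insert _ _)
    by_cases hvd' : v ∈ d'
    · exact ⟨v, hvd', hvT⟩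
    have herase : IsHittingSet (F v) (T.erase v) := fun d'' hd'' => by
      obtain ⟨w, hw, hwT⟩ := hhit d'' (.inr (Set.mem_biUnion hvd hd''))
      exact ⟨w, hw, Finset.mem_erase.2 ⟨fun h => (hFD v hd'').2 (h ▸ hw), hwT⟩⟩
    have hcard : (T.erase v).card ≤ n := by
      rw [Finset.card_erase_of_mem hvT]
      omega
    obtain ⟨w, hw, hwT⟩ := hFT v _ hcard herase d' ⟨hd', hvd'⟩
    exact ⟨w, hw, Finset.mem_of_mem_erase hwT⟩

theorem exists_finite_subfamily_forall_card_eq (hD : ∀ d ∈ D, d.Finite) (hT : IsHittingSet D T) :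
    ∃ T₀, IsHittingSet D T₀ ∧ ∃ F ⊆ D, F.Finite ∧ ∀ T' : Finset α, T'.card ≤ T₀.card →
      IsHittingSet F T' → IsHittingSet D T' ∧ T'.card = T₀.card ∧ ↑T' ⊆ ⋃₀ F := by
  classical
  obtain ⟨T₀, hT₀, hmin⟩ :=
    WellFounded.has_min (measure Finset.card).wf {T | IsHittingSet D T} ⟨T, hT⟩
  obtain ⟨F, hFD, hF, hFT⟩ := exists_finite_subfamily_of_isHittingSet hD T₀.card
  have hcard : ∀ T' : Finset α, T'.card ≤ T₀.card → IsHittingSet F T' → T₀.card ≤ T'.card :=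
    fun T' hle hT' => not_lt.1 (hmin T' (hFT T' hle hT'))
  refine ⟨T₀, hT₀, F, hFD, hF, fun T' hle hT' =>
    ⟨hFT T' hle hT', hle.antisymm (hcard T' hle hT'), ?_⟩⟩
  let T'' : Finset α := {v ∈ T' | v ∈ ⋃₀ F}
  have hsub : T'' ⊆ T' := Finset.filter_subset _ _
  have hT'' : IsHittingSet F T'' := fun d hd =>
    let ⟨v, hv, hvT⟩ := hT' d hd
    ⟨v, hv, Finset.mem_filter.2 ⟨hvT, d, hd, hv⟩⟩
  have heq : T'' = T' := Finset.eq_of_subset_of_card_le hsub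
    (hle.trans (hcard T'' ((Finset.card_le_card hsub).trans hle) hT''))
  exact fun v hv => (Finset.mem_filter.1 (heq.ge hv)).2

/-- The set `Ω` is the union of the hitting sets of minimal size. Taking preimages under `σ` is an
injective map between these sets, hence a bijective one. -/
theorem exists_finite_mapsTo_of_isHittingSet (hD : ∀ d ∈ D, d.Finite) (hT : IsHittingSet D T) :
    ∃ F ⊆ D, F.Finite ∧ ∃ Ω ⊆ ⋃₀ F, (∀ d ∈ D, (d ∩ Ω).Nonempty) ∧
      ∀ σ : α → α, (⋃₀ F).InjOn σ → (∀ d ∈ F, σ '' d ∈ D) → Set.MapsTo σ Ω Ω := by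
  classical
  obtain ⟨T₀, hT₀, F, hFD, hF, hmin⟩ := exists_finite_subfamily_forall_card_eq hD hT
  obtain ⟨U, hU⟩ := (hF.sUnion fun d hd => hD d (hFD hd)).exists_finset_coe
  let M : Set (Finset α) := {T' | IsHittingSet D T' ∧ T'.card = T₀.card}
  have hMF : ∀ T' ∈ M, ↑T' ⊆ ⋃₀ F := fun T' hT' =>
    (hmin T' hT'.2.le fun d hd => hT'.1 d (hFD hd)).2.2
  have hM : M.Finite := U.powerset.finite_toSet.subset fun T' hT' =>
    Finset.mem_coe.2 (Finset.mem_powerset.2 (Finset.coe_subset.1 ((hMF T' hT').trans hU.ge)))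
  refine ⟨F, hFD, hF, {v | ∃ T' ∈ M, v ∈ T'}, ?_, fun d hd => ?_, fun σ hσ hσD => ?_⟩
  · rintro v ⟨T', hT', hv⟩
    exact hMF T' hT' hv
  · obtain ⟨v, hv, hvT⟩ := hT₀ d hd
    exact ⟨v, hv, T₀, ⟨hT₀, rfl⟩, hvT⟩
  let pull (T' : Finset α) : Finset α := {v ∈ U | σ v ∈ T'}
  have himage : ∀ T', (pull T').image σ ⊆ T' := fun T' =>
    Finset.image_subset_iff.2 fun v hv => (Finset.mem_filter.1 hv).2
  have hcard : ∀ T', ((pull T').image σ).card = (pull T').card := fun T' =>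
    Finset.card_image_of_injOn (hσ.mono fun v hv => hU.le (Finset.mem_filter.1 hv).1)
  have hpull : Set.MapsTo pull M M := fun T' hT' => by
    have hle : (pull T').card ≤ T₀.card :=
      (hcard T').symm.trans_le ((Finset.card_le_card (himage T')).trans_eq hT'.2)
    have hhit : IsHittingSet F (pull T') := fun d hd => by
      obtain ⟨_, ⟨v, hv, rfl⟩, hvT⟩ := hT'.1 _ (hσD d hd)
      exact ⟨v, hv, Finset.mem_filter.2 ⟨hU.ge ⟨d, hd, hv⟩, hvT⟩⟩
    exact ⟨(hmin _ hle hhit).1, (hmin _ hle hhit).2.1⟩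
  have hleft : Set.LeftInvOn (Finset.image σ) pull M := fun T' hT' =>
    Finset.eq_of_subset_of_card_le (himage T') (by rw [hcard, (hpull hT').2, hT'.2])
  have hsurj : Set.SurjOn pull M M :=
    ((Set.Finite.injOn_iff_bijOn_of_mapsTo hM hpull).1 hleft.injOn).surjOn
  rintro v ⟨_, hT₁, hv⟩
  obtain ⟨T₂, hT₂, rfl⟩ := hsurj hT₁
  exact ⟨T₂, hT₂, (Finset.mem_filter.1 hv).2⟩

end HittingSet

section Acl

variable {V : Type u} {G : SimpleGraph V} {X S T Ω Θ : Set V}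

theorem exists_isEmbeddingOver_avoiding (G : SimpleGraph V) (X : Set V) (hS : S.Finite)
    (hT : T.Finite) :
    ∃ f, IsEmbeddingOver G X S f ∧ ∀ v ∈ S, f v ∈ T → v ∈ acl G X := by
  by_contra! hcon
  let D : Set (Set V) := {d | ∃ f, IsEmbeddingOver G X S f ∧ f '' (S \ acl G X) = d}
  have hD : ∀ d ∈ D, d.Finite := by
    rintro _ ⟨f, -, rfl⟩
    exact hS.sdiff.image f
  have hhit : IsHittingSet D hT.toFinset := by
    rintro _ ⟨f, hf, rfl⟩
    obtain ⟨v, hv, hvT, hvX⟩ := hcon f hf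
    exact ⟨f v, ⟨v, ⟨hv, hvX⟩, rfl⟩, hT.mem_toFinset.2 hvT⟩
  obtain ⟨F, hFD, hF, Ω, hΩF, hDΩ, hΩ⟩ := exists_finite_mapsTo_of_isHittingSet hD hhit
  have : Nonempty (V → V) := ⟨id⟩
  have hFf : ∀ d ∈ F, ∃ f, IsEmbeddingOver G X S f ∧ f '' (S \ acl G X) = d := fun d hd => hFD hd
  choose! f hf hfd using hFf
  have hFS : ⋃₀ F ⊆ ⋃ d ∈ F, f d '' S := by
    rintro v ⟨d, hd, hv⟩
    refine Set.mem_biUnion hd ?_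
    rw [← hfd d hd] at hv
    exact Set.image_mono Set.sdiff_subset hv
  have hinv : Invariant G X Ω := by
    refine ⟨_, hF.biUnion fun d _ => hS.image (f d), hΩF.trans hFS, fun σ hσ => ?_⟩
    refine hΩ σ (hσ.injOn.mono hFS) fun d hd => ⟨σ ∘ f d, ?_, ?_⟩
    · exact (hσ.mono (Set.subset_biUnion_of_mem (u := fun d => f d '' S) hd)).comp (hf d hd)
    · rw [Set.image_comp, hfd d hd]
  obtain ⟨_, ⟨v, hv, rfl⟩, hvΩ⟩ := hDΩ _ ⟨id, isEmbeddingOver_id G X S, rfl⟩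
  exact hv.2 (hinv.subset_acl hvΩ)

/-! ### Idempotence of the algebraic closure -/

/-- The permutations of `Ω` induced by embeddings over `X` of `R`. -/
def inducedPerms (G : SimpleGraph V) (X Ω R : Set V) : Set (Equiv.Perm Ω) :=
  {p | ∃ g, IsEmbeddingOver G X R g ∧ ∀ v : Ω, g v = p v}

theorem exists_finite_inducedPerms_subset (G : SimpleGraph V) (X : Set V) (hΩ : Ω.Finite) :
    ∃ S : Set V, S.Finite ∧ ∀ R, R.Finite → inducedPerms G X Ω S ⊆ inducedPerms G X Ω R := by
  have := hΩ.to_subtype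
  have hR : ∀ p : Equiv.Perm Ω, ∃ R : Set V, R.Finite ∧
      (p ∈ inducedPerms G X Ω R → ∀ R', R'.Finite → p ∈ inducedPerms G X Ω R') := fun p => by
    by_cases hp : ∀ R', R'.Finite → p ∈ inducedPerms G X Ω R'
    · exact ⟨∅, Set.finite_empty, fun _ => hp⟩
    · push Not at hp
      obtain ⟨R, hR, hpR⟩ := hp
      exact ⟨R, hR, fun h => absurd h hpR⟩
  choose R hR hRp using hR
  refine ⟨⋃ p, R p, Set.finite_iUnion hR, fun R' hR' p hp => hRp p ?_ R' hR'⟩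
  obtain ⟨g, hg, hgp⟩ := hp
  exact ⟨g, hg.mono (Set.subset_iUnion R p), hgp⟩

theorem pow_mem_inducedPerms {p : Equiv.Perm Ω}
    (hp : ∀ R, R.Finite → p ∈ inducedPerms G X Ω R) (n : ℕ) {R : Set V} (hR : R.Finite) :
    p ^ n ∈ inducedPerms G X Ω R := by
  induction n with
  | zero => exact ⟨id, isEmbeddingOver_id G X R, fun v => rfl⟩
  | succ n ih =>
    obtain ⟨g, hg, hgp⟩ := ih
    obtain ⟨h, hh, hhp⟩ := hp (g '' R) (hR.image g)
    exact ⟨h ∘ g, hh.comp hg, fun v => by simp [pow_succ', hgp, hhp]⟩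

/-- A permutation of a finite set is inverted by one of its powers, and embeddings compose. -/
theorem Invariant.exists_inverse (h : Invariant G X Ω) :
    ∃ S : Set V, S.Finite ∧ ∀ f, IsEmbeddingOver G X S f → Set.MapsTo f Ω Ω ∧
      ∀ R : Set V, R.Finite → ∃ g, IsEmbeddingOver G X R g ∧ ∀ v ∈ Ω, g (f v) = v := by
  have := h.finite.to_subtype
  obtain ⟨S₁, hS₁, hperm⟩ := exists_finite_inducedPerms_subset G X h.finite
  obtain ⟨S₂, hS₂, hΩS, hΩ⟩ := h
  refine ⟨S₁ ∪ S₂, hS₁.union hS₂, fun f hf => ?_⟩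
  have hmaps : Set.MapsTo f Ω Ω := hΩ f (hf.mono Set.subset_union_right)
  have hinj : Ω.InjOn f := hf.injOn.mono (hΩS.trans Set.subset_union_right)
  refine ⟨hmaps, fun R hR => ?_⟩
  let p : Equiv.Perm Ω :=
    .ofBijective hmaps.restrict (Finite.injective_iff_bijective.1 (hmaps.restrict_inj.2 hinj))
  have hp : ∀ R, R.Finite → p ∈ inducedPerms G X Ω R := fun R hR =>
    hperm R hR ⟨f, hf.mono Set.subset_union_left, fun v => rfl⟩
  obtain ⟨n, hn : p ^ n = p⁻¹⟩ := mem_powers_iff_mem_zpowers.2 (inv_mem (Subgroup.mem_zpowers p))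
  obtain ⟨g, hg, hgp⟩ := pow_mem_inducedPerms hp n hR
  exact ⟨g, hg, fun v hv => (hgp (p ⟨v, hv⟩)).trans (by simp [hn])⟩

/-- Embeddings that agree on `Ω` but take different values at `y` can be followed by an embedding
inverting their common restriction to `Ω`, which moves all these values into the finite set `Θ`. -/
theorem finite_image_of_exists_inverse {y : V} (hS : S.Finite) (hΘS : Θ ⊆ S) (hy : y ∈ Θ)
    (hΘ : ∀ f, IsEmbeddingOver G X S f → (∀ v ∈ Ω, f v = v) → Set.MapsTo f Θ Θ)
    (hinverse : ∀ f, IsEmbeddingOver G X S f → ∀ R : Set V, R.Finite →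
      ∃ g, IsEmbeddingOver G X R g ∧ ∀ v ∈ Ω, g (f v) = v) (r : Ω → V) :
    {z | ∃ f, IsEmbeddingOver G X S f ∧ (∀ v : Ω, f v = r v) ∧ f y = z}.Finite := by
  by_contra hinf
  obtain ⟨t, htr, ht⟩ := Set.Infinite.exists_subset_card_eq hinf (Θ.ncard + 1)
  have htf : ∀ z ∈ t, ∃ f, IsEmbeddingOver G X S f ∧ (∀ v : Ω, f v = r v) ∧ f y = z :=
    fun z hz => htr hz
  have : Nonempty (V → V) := ⟨id⟩
  choose! f hf hfr hfy using htf
  obtain ⟨z₀, hz₀⟩ : t.Nonempty := Finset.card_pos.1 (by omega)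
  obtain ⟨g, hg, hgf⟩ := hinverse (f z₀) (hf z₀ hz₀) (⋃ z ∈ t, f z '' S)
    (t.finite_toSet.biUnion fun z _ => hS.image (f z))
  have hgt : ∀ z ∈ t, g z ∈ Θ := fun z hz => by
    have hgfz : IsEmbeddingOver G X S (g ∘ f z) :=
      (hg.mono (Set.subset_biUnion_of_mem (u := fun z => f z '' S) hz)).comp (hf z hz)
    have hfix : ∀ v ∈ Ω, g (f z v) = v := fun v hv => by
      rw [hfr z hz ⟨v, hv⟩, ← hfr z₀ hz₀ ⟨v, hv⟩, hgf v hv]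
    simpa only [Function.comp_apply, hfy z hz] using hΘ _ hgfz hfix hy
  have htS : (t : Set V) ⊆ ⋃ z ∈ t, f z '' S := fun z hz =>
    Set.mem_biUnion hz ⟨y, hΘS hy, hfy z hz⟩
  have hcard := Set.ncard_le_ncard_of_injOn g hgt (hg.injOn.mono htS) (hS.subset hΘS)
  rw [Set.ncard_coe_finset] at hcard
  omega

theorem acl_acl_subset (G : SimpleGraph V) (X : Set V) : acl G (acl G X) ⊆ acl G X := by
  intro y hy
  obtain ⟨Θ, ⟨S, hS, hΘS, hΘ⟩, hyΘ⟩ := exists_invariant_of_mem_acl hy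
  obtain ⟨Ω, hΩ, hSΩ⟩ := exists_invariant_of_subset_acl (hS.inter_of_left (acl G X))
    Set.inter_subset_right
  have := hΩ.finite.to_subtype
  obtain ⟨T, hT, hinverse⟩ := hΩ.exists_inverse
  have hinverse' := fun f (hf : IsEmbeddingOver G X (S ∪ T) f) =>
    hinverse f (hf.mono Set.subset_union_right)
  have hconj (r : Ω → Ω) := finite_image_of_exists_inverse (hS.union hT)
    (hΘS.trans Set.subset_union_left) hyΘ
    (fun f hf hfΩ => hΘ f ⟨hf.toIsEmbeddingOn.mono Set.subset_union_left, fun v hv hvX =>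
      hfΩ v (hSΩ ⟨hv, hvX⟩)⟩)
    (fun f hf => (hinverse' f hf).2) (fun v => r v)
  refine mem_acl_iff.2 ⟨S ∪ T, hS.union hT, .inl (hΘS hyΘ), (Set.finite_iUnion hconj).subset ?_⟩
  rintro _ ⟨f, hf, rfl⟩
  exact Set.mem_iUnion_of_mem (hinverse' f hf).1.restrict ⟨f, hf, fun v => rfl, rfl⟩

end Acl

/-! ### Freeness -/

section Free

variable {V : Type u} {G : SimpleGraph V} {H : G.Subgraph} {A X Z : Set V}

theorem freeOver_verts (H : G.Subgraph) : FreeOver G H.verts H := by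
  have hrange : Set.range (H.coeCopy : H.verts → V) = H.verts := Subtype.range_coe
  exact ⟨fun _ => H.coeCopy, fun _ _ _ => rfl, fun _ _ _ => by rw [hrange, Set.inter_self]⟩

theorem FreeOver.exists_avoiding (h : FreeOver G Z H) {S : Set V} (hS : S.Finite) :
    ∃ f : H.coe.Copy G, (∀ x : H.verts, (x : V) ∈ Z → f x = x) ∧ Set.range f ∩ S ⊆ Z := by
  obtain ⟨f, hfZ, hf⟩ := h
  by_contra! hcon
  have hex : ∀ k, ∃ s, s ∈ Set.range (f k) ∧ s ∈ S ∧ s ∉ Z := fun k => by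
    obtain ⟨s, hs, hsZ⟩ := Set.not_subset.1 (hcon (f k) (hfZ k))
    exact ⟨s, hs.1, hs.2, hsZ⟩
  choose s hsr hsS hsZ using hex
  have hinj : Function.Injective s := fun i j hij => by
    by_contra hne
    exact hsZ i ((hf i j hne).subset ⟨hsr i, hij ▸ hsr j⟩)
  exact Set.infinite_of_injective_forall_mem hinj hsS hS

theorem freeOver_of_forall_exists_avoiding (hH : H.verts.Finite) (hZ : Z ⊆ H.verts)
    (h : ∀ S : Set V, S.Finite → ∃ f : H.coe.Copy G,
      (∀ x : H.verts, (x : V) ∈ Z → f x = x) ∧ Set.range f ∩ S ⊆ Z) : FreeOver G Z H := by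
  have := hH.to_subtype
  let r (f g : H.coe.Copy G) : Prop := Set.range f ∩ Set.range g ⊆ Z
  have : Std.Symm r := ⟨fun f g hfg => (Set.inter_comm _ _).trans_subset hfg⟩
  obtain ⟨f, hfZ, hf⟩ := exists_seq_of_forall_finset_exists'
    (fun f : H.coe.Copy G => ∀ x : H.verts, (x : V) ∈ Z → f x = x) r fun s _ => by
      obtain ⟨f, hfZ, hf⟩ := h (⋃ g ∈ s, Set.range g)
        (s.finite_toSet.biUnion fun g _ => Set.finite_range g)
      exact ⟨f, hfZ, fun g hg v hv => hf ⟨hv.2, Set.mem_biUnion hg hv.1⟩⟩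
  have hZf : ∀ i, Z ⊆ Set.range (f i) := fun i z hz => ⟨⟨z, hZ hz⟩, hfZ i _ hz⟩
  exact ⟨f, hfZ, fun i j hij => (hf hij).antisymm (Set.subset_inter (hZf i) (hZf j))⟩

theorem exists_freeOver_of_cl_subset (hH : H.verts.Finite) (hA : A ⊆ H.verts)
    (h : cl G A H ⊆ X) : ∃ B ⊆ X, B ⊆ H.verts ∧ FreeOver G (A ∪ B) H := by
  have hfin : {B' : Set V | B' ⊆ H.verts ∧ FreeOver G (A ∪ B') H}.Finite :=
    hH.finite_subsets.subset fun B' h => h.1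
  obtain ⟨B, hB⟩ := hfin.exists_minimal ⟨H.verts, subset_rfl, by
    rw [Set.union_eq_self_of_subset_left hA]
    exact freeOver_verts H⟩
  exact ⟨B, fun b hb => h (Or.inr ⟨B, hB, hb⟩), hB.prop.1, hB.prop.2⟩

theorem IsEmbeddingOn.exists_copy {N W : Type*} {C : SimpleGraph N} {K : SimpleGraph W}
    {S : Set V} {f : V → W} (hf : IsEmbeddingOn G K S f) (k : C.Copy G) (hk : Set.range k ⊆ S) :
    ∃ k' : C.Copy K, ∀ x, k' x = f (k x) := by
  have hkS : ∀ x, k x ∈ S := fun x => hk ⟨x, rfl⟩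
  exact ⟨⟨⟨f ∘ k, fun {x y} hxy => (hf.adj_iff _ (hkS x) _ (hkS y)).2 (k.toHom.map_adj hxy)⟩,
    fun x y hxy => k.injective (hf.injOn (hkS x) (hkS y) hxy)⟩, fun x => rfl⟩

/-- A copy of `H` over `A ∪ B` can be moved by embeddings over `X` so that it avoids any finite set
outside `X`, hence `H` is free over `A ∪ B ∩ X`. -/
theorem cl_subset_of_acl_subset (hX : acl G X ⊆ X) (hH : H.verts.Finite) (hA : A ⊆ H.verts)
    (hAX : A ⊆ X) : cl G A H ⊆ X := by
  refine Set.union_subset hAX (Set.sUnion_subset fun B hB => ?_)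
  replace hB : Minimal (fun B' => B' ⊆ H.verts ∧ FreeOver G (A ∪ B') H) B := hB
  have hBH : B ⊆ H.verts := hB.prop.1
  have := hH.to_subtype
  suffices hfree : FreeOver G (A ∪ B ∩ X) H from
    (hB.le_of_le (y := B ∩ X) ⟨Set.inter_subset_left.trans hBH, hfree⟩
      Set.inter_subset_left).trans
      Set.inter_subset_right
  refine freeOver_of_forall_exists_avoiding hH
    (Set.union_subset hA (Set.inter_subset_left.trans hBH)) fun S hS => ?_
  obtain ⟨k, hkAB, hkS⟩ := hB.prop.2.exists_avoiding hS
  obtain ⟨f, hf, hfS⟩ := exists_isEmbeddingOver_avoiding G X (Set.finite_range k) hS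
  obtain ⟨k', hk'⟩ := hf.toIsEmbeddingOn.exists_copy k subset_rfl
  have hfix : ∀ x, k x ∈ X → k' x = k x := fun x hx => (hk' x).trans (hf.fix _ ⟨x, rfl⟩ hx)
  refine ⟨k', fun x hx => ?_, ?_⟩
  · have hkx := hkAB x (Set.union_subset_union_right A Set.inter_subset_left hx)
    rw [hfix x (hkx ▸ hx.elim (fun h => hAX h) And.right), hkx]
  · rintro _ ⟨⟨x, rfl⟩, hxS⟩
    have hkX : k x ∈ X := hX (hfS _ ⟨x, rfl⟩ (hk' x ▸ hxS))
    rw [hfix x hkX] at hxS ⊢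
    exact (hkS ⟨⟨x, rfl⟩, hxS⟩).imp id fun hB => ⟨hB, hkX⟩

theorem IsoPair.finite_verts {p : GraphPair} (h : IsoPair A H p) : H.verts.Finite := by
  obtain ⟨-, e, -⟩ := h
  exact Finite.of_equiv _ e.symm.toEquiv

theorem subset_clFam (G : SimpleGraph V) (F : Set GraphPair) (X : Set V) : X ⊆ clFam G F X :=
  Set.subset_union_left

theorem clFam_mono (G : SimpleGraph V) {F F' : Set GraphPair} (h : F ⊆ F') (X : Set V) :
    clFam G F X ⊆ clFam G F' X := by
  refine Set.union_subset_union_right X ?_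
  rintro y ⟨A, H, hA, ⟨p, hp, hiso⟩, hy⟩
  exact ⟨A, H, hA, ⟨p, h hp, hiso⟩, hy⟩

theorem clFam_subset_of_acl_subset (F : Set GraphPair) (hX : acl G X ⊆ X) :
    clFam G F X ⊆ X := by
  refine Set.union_subset subset_rfl ?_
  rintro y ⟨A, H, hA, ⟨p, -, hiso⟩, hy⟩
  exact cl_subset_of_acl_subset hX hiso.finite_verts hiso.1 hA hy

end Free

/-! ### Amalgamating two copies of a graph -/

section Double

variable {V : Type u} (G : SimpleGraph V) (X : Set V)

/-- The vertices of two copies of a graph that share the vertices in `X`; the shared vertices carry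
the index `false`. -/
abbrev DoubleVert (X : Set V) : Type u := {p : V × Bool // p.1 ∈ X → p.2 = false}

/-- The free amalgam of two copies of `G` over `X`. -/
def double : SimpleGraph (DoubleVert X) where
  Adj p q := G.Adj p.1.1 q.1.1 ∧ (p.1.1 ∈ X ∨ q.1.1 ∈ X ∨ p.1.2 = q.1.2)
  symm := ⟨fun _ _ h => ⟨h.1.symm, by tauto⟩⟩
  loopless := ⟨fun _ h => G.loopless.irrefl _ h.1⟩

/-- The vertices of the copy number `i` of the graph in the amalgam over `X`. -/
def side (i : Bool) : Set (DoubleVert X) := {p | p.1.1 ∈ X ∨ p.1.2 = i}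

open Classical in
/-- The copy number `i` of `G` in the amalgam over `X`. -/
noncomputable def inclusion (i : Bool) : G ↪g double G X where
  toFun v := ⟨(v, if v ∈ X then false else i), fun h => if_pos h⟩
  inj' _ _ h := congrArg (fun p : DoubleVert X => p.1.1) h
  map_rel_iff' {v w} := by
    change (G.Adj v w ∧ (v ∈ X ∨ w ∈ X ∨
      (if v ∈ X then false else i) = if w ∈ X then false else i)) ↔ G.Adj v w
    by_cases hv : v ∈ X <;> by_cases hw : w ∈ X <;> simp [hv, hw]

variable {G X} {p q : DoubleVert X} {i j : Bool}

theorem inclusion_mem_side (i : Bool) (v : V) : inclusion G X i v ∈ side X i := by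
  by_cases h : v ∈ X
  · exact .inl h
  · exact .inr (if_neg h)

theorem mem_side_iff_of_fst_notMem (hp : p.1.1 ∉ X) : p ∈ side X i ↔ p.1.2 = i :=
  ⟨fun h => h.resolve_left hp, .inr⟩

theorem fst_mem_of_mem_side_of_mem_side (hi : p ∈ side X i) (hj : p ∈ side X j) (hij : i ≠ j) :
    p.1.1 ∈ X := by
  by_contra h
  rw [mem_side_iff_of_fst_notMem h] at hi hj
  exact hij (hi.symm.trans hj)

theorem double_ext (h : p.1.1 = q.1.1) (hp : p.1.1 ∈ X) : p = q :=
  Subtype.ext (Prod.ext h ((p.2 hp).trans (q.2 (h ▸ hp)).symm))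

theorem injOn_fst_side : (side X i).InjOn fun p => p.1.1 := fun p hp q hq (h : p.1.1 = q.1.1) => by
  by_cases hpX : p.1.1 ∈ X
  · exact double_ext h hpX
  · exact Subtype.ext (Prod.ext h ((hp.resolve_left hpX).trans (hq.resolve_left (h ▸ hpX)).symm))

theorem double_adj_mem_side (h : (double G X).Adj p q) (hp : p ∈ side X i) (hpX : p.1.1 ∉ X) :
    q ∈ side X i := by
  rw [mem_side_iff_of_fst_notMem hpX] at hp
  rcases h.2 with h | h | h
  · exact absurd h hpX
  · exact .inl h
  · exact .inr (h.symm.trans hp)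

theorem memG_double {𝒞 : Set FinGraph} (hG : MemG 𝒞 G) (h : Omits 𝒞 (double G X)) :
    MemG 𝒞 (double G X) := by
  have := hG.1
  exact ⟨inferInstance, h⟩

/-- An embedding of a finite part of the amalgam in `G` that is the identity on the first copy maps
the second copy of `x` to a conjugate `y ∈ S` of `x`, which is already the image of the first copy
of `y`. -/
theorem acl_subset_of_omits_double {𝒞 : Set FinGraph} (hG : MemE 𝒞 G)
    (h : Omits 𝒞 (double G X)) : acl G X ⊆ X := by
  intro x hx
  by_contra hxX
  have : Nonempty V := ⟨x⟩
  obtain ⟨Ω, ⟨S, hS, hΩS, hΩ⟩, hxΩ⟩ := exists_invariant_of_mem_acl hx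
  obtain ⟨g, hg, hgi⟩ := hG.exists_isEmbeddingOn (memG_double hG.1 h) (inclusion G X false)
    ((hS.image (inclusion G X true)).union (hS.image (inclusion G X false)))
  have hgS : ∀ v ∈ S, g (inclusion G X false v) = v := fun v hv => hgi v (.inr ⟨v, hv, rfl⟩)
  have hf : IsEmbeddingOver G X S (g ∘ inclusion G X true) := by
    refine ⟨(hg.mono Set.subset_union_left).comp (isEmbeddingOn_embedding _ S), fun v hv hvX => ?_⟩
    have hv' : inclusion G X true v = inclusion G X false v := double_ext rfl hvX
    rw [Function.comp_apply, hv', hgS v hv]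
  set y := g (inclusion G X true x)
  have hyS : y ∈ S := hΩS (hΩ _ hf hxΩ)
  have heq : inclusion G X false y = inclusion G X true x :=
    hg.injOn (.inr ⟨y, hyS, rfl⟩) (.inl ⟨x, hΩS hxΩ, rfl⟩) (hgS y hyS)
  exact hxX (fst_mem_of_mem_side_of_mem_side (inclusion_mem_side true x)
    (heq ▸ inclusion_mem_side false y) (by decide))

end Double

/-! ### Branches of solid graphs -/

section Solid

variable {N : Type*} {C : SimpleGraph N} {a q v x y z : N}

theorem connected_induce_of_forall_walk {S : Set N} (hx : x ∈ S)
    (h : ∀ v ∈ S, ∃ w : C.Walk x v, ∀ u ∈ w.support, u ∈ S) : (C.induce S).Connected :=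
  SimpleGraph.connected_iff_exists_forall_reachable _ |>.2 ⟨⟨x, hx⟩, fun v =>
    let ⟨w, hw⟩ := h v v.2
    ⟨w.induce S hw⟩⟩

theorem connected_induce_induce {S : Set N} {T : Set S}
    (h : (C.induce (Subtype.val '' T)).Connected) : ((C.induce S).induce T).Connected := by
  let e : (C.induce S).induce T ≃g C.induce (Subtype.val '' T) :=
    ⟨Equiv.Set.image _ T Subtype.val_injective, Iff.rfl⟩
  exact e.connected_iff.2 h

/-- A vertex other than `v` lies on at most one of the two arcs from `q` to `v` of the cycle formed
by `q` and the path `w`. -/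
theorem exists_walk_avoiding (hqx : C.Adj q x) (hqy : C.Adj q y) {w : C.Walk x y}
    (hw : w.IsPath) (hv : v ∈ w.support) (hzq : z ≠ q) (hzv : z ≠ v) :
    ∃ r : C.Walk q v, ∀ u ∈ r.support, u ∈ insert q {u | u ∈ w.support} \ {z} := by
  obtain ⟨p, r, rfl⟩ := w.mem_support_iff_exists_append.1 hv
  by_cases hzp : z ∈ p.support
  · have hzr : z ∉ r.support := fun h => hw.ne_of_mem_support_of_append hzv hzp h rfl
    refine ⟨.cons hqy r.reverse, fun u hu => ?_⟩
    rw [SimpleGraph.Walk.support_cons, List.mem_cons, SimpleGraph.Walk.support_reverse,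
      List.mem_reverse] at hu
    refine ⟨hu.imp id fun hu => ?_, ?_⟩
    · exact (SimpleGraph.Walk.mem_support_append_iff _ _).2 (.inr hu)
    · rintro rfl
      exact hu.elim hzq hzr
  · refine ⟨.cons hqx p, fun u hu => ?_⟩
    rw [SimpleGraph.Walk.support_cons, List.mem_cons] at hu
    refine ⟨hu.imp id fun hu => ?_, ?_⟩
    · exact (SimpleGraph.Walk.mem_support_append_iff _ _).2 (.inl hu)
    · rintro rfl
      exact hu.elim hzq hzp

theorem twoConnected_induce_cycle (hqx : C.Adj q x) (hqy : C.Adj q y) (hxy : x ≠ y)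
    {w : C.Walk x y} (hw : w.IsPath) (hq : q ∉ w.support) :
    TwoConnected (C.induce (insert q {u | u ∈ w.support})) := by
  refine ⟨?_, ?_, ?_⟩
  · have hcard : ({q, x, y} : Set N).encard = 3 :=
      Set.encard_eq_three.2 ⟨q, x, y, hqx.ne, hqy.ne, hxy, rfl⟩
    refine hcard ▸ Set.encard_le_encard (Set.insert_subset_insert (Set.pair_subset ?_ ?_))
    exacts [w.start_mem_support, w.end_mem_support]
  · exact C.connected_induce_union (s := {q}) .of_subsingleton
      w.connected_induce_support.preconnected rfl w.start_mem_support hqx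
  · rintro ⟨z, hz⟩
    refine connected_induce_induce ?_
    have himage : Subtype.val '' ({⟨z, hz⟩}ᶜ : Set ↑(insert q {u | u ∈ w.support})) =
        insert q {u | u ∈ w.support} \ {z} := by
      ext u
      simp
    rw [himage]
    by_cases hzq : z = q
    · subst hzq
      rw [Set.insert_sdiff_self_of_notMem (s := {u | u ∈ w.support}) hq]
      exact w.connected_induce_support
    · refine connected_induce_of_forall_walk ⟨.inl rfl, Ne.symm hzq⟩ ?_
      rintro v ⟨rfl | hv, hvz⟩
      · exact ⟨.nil, by simpa using Ne.symm hzq⟩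
      · exact exists_walk_avoiding hqx hqy hw hv hzq (Ne.symm hvz)

theorem Solid.adj_of_walk (hC : Solid C) (hqx : C.Adj q x) (hqy : C.Adj q y) (hxy : x ≠ y)
    {w : C.Walk x y} (hq : q ∉ w.support) : C.Adj x y := by
  classical
  have htop := hC _ (twoConnected_induce_cycle hqx hqy hxy w.bypass_isPath
    fun h => hq (w.support_bypass_subset_support h))
  have hadj : (C.induce (insert q {u | u ∈ w.bypass.support})).Adj
      ⟨x, .inr w.bypass.start_mem_support⟩ ⟨y, .inr w.bypass.end_mem_support⟩ := by
    rw [htop]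
    exact fun h => hxy (congrArg Subtype.val h)
  exact hadj

/-- The vertices of a branch at `a`: a component of the complement of `a`, as a set of vertices of
`C`. The root `a` is not included. -/
def branchVerts {a : N} (K : (C.induce {a}ᶜ).ConnectedComponent) : Set N :=
  Subtype.val '' K.supp

variable {K : (C.induce {a}ᶜ).ConnectedComponent} {L : (C.induce {q}ᶜ).ConnectedComponent}

theorem notMem_branchVerts (K : (C.induce {a}ᶜ).ConnectedComponent) : a ∉ branchVerts K := by
  rintro ⟨⟨z, hz⟩, -, hza⟩
  exact hz hza

theorem mem_branchVerts_of_adj (hx : x ∈ branchVerts K) (h : C.Adj x y) (hy : y ≠ a) :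
    y ∈ branchVerts K := by
  obtain ⟨x, hx, rfl⟩ := hx
  exact ⟨⟨y, hy⟩, K.mem_supp_of_adj_mem_supp hx h, rfl⟩

theorem mem_branchVerts_of_walk {w : C.Walk x y} (hx : x ∈ branchVerts K) (hw : a ∉ w.support) :
    y ∈ branchVerts K := by
  induction w with
  | nil => exact hx
  | cons h p ih =>
    rw [SimpleGraph.Walk.support_cons, List.mem_cons, not_or] at hw
    exact ih (mem_branchVerts_of_adj hx h fun hy => hw.2 (hy ▸ p.start_mem_support)) hw.2

theorem exists_walk_of_mem_branchVerts (hx : x ∈ branchVerts K) (hy : y ∈ branchVerts K) :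
    ∃ w : C.Walk x y, ∀ u ∈ w.support, u ∈ branchVerts K := by
  obtain ⟨x, hx, rfl⟩ := hx
  obtain ⟨y, hy, rfl⟩ := hy
  obtain ⟨w⟩ := SimpleGraph.ConnectedComponent.exact (hx.trans hy.symm)
  let f : C.induce {a}ᶜ ↪g C := SimpleGraph.Embedding.induce {a}ᶜ
  have hw : ∀ u ∈ (w.map f.toHom).support, u ∈ branchVerts K := fun u hu => by
    rw [SimpleGraph.Walk.support_map, List.mem_map] at hu
    obtain ⟨u, hu, rfl⟩ := hu
    obtain ⟨p, r, rfl⟩ := w.mem_support_iff_exists_append.1 hu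
    exact ⟨u, (SimpleGraph.ConnectedComponent.sound p.reachable).symm.trans hx, rfl⟩
  exact ⟨_, hw⟩

theorem exists_mem_branchVerts (h : v ≠ a) :
    ∃ K : (C.induce {a}ᶜ).ConnectedComponent, v ∈ branchVerts K :=
  ⟨(C.induce {a}ᶜ).connectedComponentMk ⟨v, h⟩, ⟨v, h⟩, rfl, rfl⟩

theorem Solid.adj_of_mem_branchVerts (hC : Solid C) (hx : x ∈ branchVerts K)
    (hy : y ∈ branchVerts K) (hax : C.Adj a x) (hay : C.Adj a y) (hxy : x ≠ y) : C.Adj x y :=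
  let ⟨_, hw⟩ := exists_walk_of_mem_branchVerts hx hy
  hC.adj_of_walk hax hay hxy fun h => notMem_branchVerts K (hw a h)

theorem branchVerts_ssubset (hq : q ∈ branchVerts K) (hvK : v ∈ branchVerts K)
    (hvL : v ∈ branchVerts L) (haL : a ∉ branchVerts L) : branchVerts L ⊂ branchVerts K := by
  refine ⟨fun u hu => ?_, fun h => notMem_branchVerts L (h hq)⟩
  obtain ⟨w, hw⟩ := exists_walk_of_mem_branchVerts hvL hu
  exact mem_branchVerts_of_walk hvK fun h => haL (hw a h)

/-- The neighbour of `a` on a shortest path from `a` to `v` separates them: otherwise `a` would be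
adjacent to the next vertex of the path, by solidity. -/
theorem Solid.exists_branchVerts_ssubset (hC : Solid C) (hconn : C.Connected)
    (hv : v ∈ branchVerts K) (hav : ¬ C.Adj a v) :
    ∃ q ∈ branchVerts K, C.Adj a q ∧ ∃ L : (C.induce {q}ᶜ).ConnectedComponent,
      v ∈ branchVerts L ∧ branchVerts L ⊂ branchVerts K := by
  obtain ⟨w, hw⟩ := hconn.exists_walk_length_eq_dist a v
  have hpath := w.isPath_of_length_eq_dist hw
  match w, hw, hpath with
  | .nil, _, _ => exact absurd hv (notMem_branchVerts K)
  | .cons h .nil, _, _ => exact absurd h hav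
  | .cons (v := q) haq (.cons (v := x) hqx p), hw, hpath =>
    rw [SimpleGraph.Walk.cons_isPath_iff, SimpleGraph.Walk.cons_isPath_iff] at hpath
    obtain ⟨⟨-, hqp⟩, hap⟩ := hpath
    have hqK : q ∈ branchVerts K := by
      refine mem_branchVerts_of_walk (w := (SimpleGraph.Walk.cons hqx p).reverse) hv ?_
      rwa [SimpleGraph.Walk.support_reverse, List.mem_reverse]
    obtain ⟨L, hxL⟩ := exists_mem_branchVerts (C := C) hqx.ne'
    have hvL : v ∈ branchVerts L := mem_branchVerts_of_walk hxL hqp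
    refine ⟨q, hqK, haq, L, hvL, branchVerts_ssubset hqK hv hvL fun haL => ?_⟩
    have hax : a ≠ x := fun h => hap (by simp [h])
    have hadj := hC.adj_of_mem_branchVerts haL hxL haq.symm hqx hax
    have hdist := SimpleGraph.dist_le (.cons hadj p)
    simp only [SimpleGraph.Walk.length_cons] at hdist hw
    omega

end Solid

/-! ### Moving branches between the two copies -/

section Move

variable {M N W : Type*} {V : Type u} {B : SimpleGraph M} {C : SimpleGraph N} {D : SimpleGraph W}
  {G : SimpleGraph V} {X : Set V} {i j : Bool} {a : N} {K : (C.induce {a}ᶜ).ConnectedComponent}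

/-- The graph `B` with root `b` is movable over `X`: every copy of it in `G` with its root in `X`
can be replaced by one with the same root that meets a given finite set only in vertices of `X` that
belong to the old copy. -/
def Movable (B : SimpleGraph M) (b : M) (G : SimpleGraph V) (X : Set V) : Prop :=
  ∀ e : B.Copy G, e b ∈ X → ∀ S : Set V, S.Finite →
    ∃ e' : B.Copy G, e' b = e b ∧ Set.range e' ∩ S ⊆ X ∩ Set.range e

/-- The set `L` is gatherable at `a`: in every copy of `C` in the double of `G` over `X`, the
vertices in `L` can be moved to any side on which `a` lies, all others being fixed. -/
def Gatherable (C : SimpleGraph N) (G : SimpleGraph V) (X : Set V) (a : N) (L : Set N) : Prop :=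
  ∀ (g : C.Copy (double G X)) (i : Bool), g a ∈ side X i →
    ∃ g' : C.Copy (double G X), (∀ v ∉ L, g' v = g v) ∧ ∀ v ∈ L, g' v ∈ side X i

theorem exists_copy_of_forall_mem_side (g : B.Copy (double G X)) (hg : ∀ v, g v ∈ side X j) :
    ∃ k : B.Copy G, ∀ v, k v = (g v).1.1 :=
  ⟨⟨⟨fun v => (g v).1.1, fun h => (g.toHom.map_adj h).1⟩, fun v w h =>
    g.injective (injOn_fst_side (hg v) (hg w) h)⟩, fun _ => rfl⟩

theorem exists_subset_side_of_isClique {Q : Set (DoubleVert X)} (hQ : (double G X).IsClique Q) :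
    ∃ j, Q ⊆ side X j := by
  by_cases h : ∃ p ∈ Q, p.1.1 ∉ X
  · obtain ⟨p, hp, hpX⟩ := h
    refine ⟨p.1.2, fun q hq => ?_⟩
    obtain rfl | hpq := eq_or_ne p q
    · exact .inr rfl
    · exact double_adj_mem_side (hQ hp hq hpq) (.inr rfl) hpX
  · push Not at h
    exact ⟨false, fun q hq => .inl (h q hq)⟩

theorem exists_copy_glue (g : C.Copy D) (k : (C.induce (insert a (branchVerts K))).Copy D)
    (ha : k ⟨a, .inl rfl⟩ = g a) (hne : ∀ u, ↑u ∈ branchVerts K → ∀ v ∉ branchVerts K, k u ≠ g v) :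
    ∃ g' : C.Copy D, (∀ v ∉ branchVerts K, g' v = g v) ∧
      ∀ v : ↑(insert a (branchVerts K)), g' v = k v := by
  classical
  let f (v : N) : W := if h : v ∈ branchVerts K then k ⟨v, .inr h⟩ else g v
  have hfg : ∀ v ∉ branchVerts K, f v = g v := fun v hv => dif_neg hv
  have hfk : ∀ v : ↑(insert a (branchVerts K)), f v = k v := by
    rintro ⟨v, rfl | hv⟩
    · exact (hfg v (notMem_branchVerts K)).trans ha.symm
    · exact dif_pos hv
  have hadj_of_mem : ∀ u v, C.Adj u v → u ∈ branchVerts K → D.Adj (f u) (f v) := by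
    intro u v huv hu
    have hv : v ∈ insert a (branchVerts K) := or_iff_not_imp_left.2 (mem_branchVerts_of_adj hu huv)
    have hkuv : D.Adj (k ⟨u, .inr hu⟩) (k ⟨v, hv⟩) := k.toHom.map_adj huv
    rwa [← hfk, ← hfk] at hkuv
  have hadj : ∀ u v, C.Adj u v → D.Adj (f u) (f v) := by
    intro u v huv
    by_cases hu : u ∈ branchVerts K
    · exact hadj_of_mem u v huv hu
    by_cases hv : v ∈ branchVerts K
    · exact (hadj_of_mem v u huv.symm hv).symm
    rw [hfg u hu, hfg v hv]
    exact g.toHom.map_adj huv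
  have hsep : ∀ u ∈ branchVerts K, ∀ v ∉ branchVerts K, f u ≠ f v := by
    intro u hu v hv
    rw [hfk ⟨u, .inr hu⟩, hfg v hv]
    exact hne _ hu v hv
  have hinj : Function.Injective f := by
    intro u v huv
    by_cases hu : u ∈ branchVerts K <;> by_cases hv : v ∈ branchVerts K
    · rw [hfk ⟨u, .inr hu⟩, hfk ⟨v, .inr hv⟩] at huv
      exact congrArg Subtype.val (k.injective huv)
    · exact absurd huv (hsep u hu v hv)
    · exact absurd huv.symm (hsep v hv u hu)
    · rw [hfg u hu, hfg v hv] at huv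
      exact g.injective huv
  exact ⟨⟨⟨f, hadj _ _⟩, hinj⟩, hfg, hfk⟩

theorem exists_copy_switch [Finite N]
    (hmov : Movable (C.induce (insert a (branchVerts K))) ⟨a, .inl rfl⟩ G X)
    (g : C.Copy (double G X)) (hg : ∀ v ∈ insert a (branchVerts K), g v ∈ side X j)
    (ha : (g a).1.1 ∈ X) (i : Bool) :
    ∃ g' : C.Copy (double G X), (∀ v ∉ branchVerts K, g' v = g v) ∧
      ∀ v ∈ branchVerts K, g' v ∈ side X i := by
  obtain ⟨e, he⟩ := exists_copy_of_forall_mem_side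
    (g.comp (SimpleGraph.Copy.induce C (insert a (branchVerts K)))) fun v => hg v v.2
  replace he : ∀ v, e v = (g v).1.1 := he
  obtain ⟨e', hea, heS⟩ := hmov e (by rwa [he]) _ (Set.finite_range fun v => (g v).1.1)
  have hea' : e' ⟨a, .inl rfl⟩ = (g a).1.1 := hea.trans (he _)
  obtain ⟨g', hg', hg'e⟩ := exists_copy_glue g ((inclusion G X i).toCopy.comp e')
    (double_ext hea' (hea'.symm ▸ ha :)) fun u hu v hv huv => by
      have huv' : e' u = (g v).1.1 := congrArg (fun p : DoubleVert X => p.1.1) huv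
      obtain ⟨huX, w, hwu⟩ := heS ⟨⟨u, rfl⟩, v, huv'.symm⟩
      have hwv : (w : N) = v :=
        g.injective (double_ext ((he w).symm.trans (hwu.trans huv')) (he w ▸ hwu ▸ huX))
      obtain rfl : v = a := (hwv ▸ w.2).resolve_right hv
      have hua : u = ⟨v, .inl rfl⟩ := e'.injective (huv'.trans hea'.symm)
      exact hv (by rwa [hua] at hu)
  exact ⟨g', hg', fun v hv => hg'e ⟨v, .inr hv⟩ ▸ inclusion_mem_side (G := G) i _⟩

theorem exists_copy_gather [Finite N] {M Q : Set N}
    (hM : ∀ v ∈ M, v ∉ Q → ∃ q ∈ Q, ∃ L ⊆ M, v ∈ L ∧ Gatherable C G X q L)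
    (g : C.Copy (double G X)) (hg : ∀ q ∈ Q, g q ∈ side X j) :
    ∃ g' : C.Copy (double G X), (∀ v ∉ M, g' v = g v) ∧ ∀ v ∈ M, g' v ∈ side X j := by
  suffices h : ∀ T ⊆ M, ∃ g' : C.Copy (double G X),
      (∀ v ∉ M, g' v = g v) ∧ ∀ v ∈ Q ∪ T, g' v ∈ side X j from
    let ⟨g', hg', hg'M⟩ := h M subset_rfl
    ⟨g', hg', fun v hv => hg'M v (.inr hv)⟩
  intro T hT
  induction T, T.toFinite using Set.Finite.induction_on with
  | empty => exact ⟨g, fun _ _ => rfl, fun v hv => hg v (hv.resolve_right id)⟩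
  | @insert v T hvT _ ih =>
    obtain ⟨g₁, hg₁, hg₁T⟩ := ih ((Set.subset_insert v T).trans hT)
    by_cases hvQ : v ∈ Q
    · refine ⟨g₁, hg₁, fun u hu => hg₁T u ?_⟩
      rcases hu with hu | rfl | hu
      exacts [.inl hu, .inl hvQ, .inr hu]
    obtain ⟨q, hq, L, hLM, hvL, hL⟩ := hM v (hT (.inl rfl)) hvQ
    obtain ⟨g₂, hg₂, hg₂L⟩ := hL g₁ j (hg₁T q (.inl hq))
    refine ⟨g₂, fun u hu => (hg₂ u fun h => hu (hLM h)).trans (hg₁ u hu), fun u hu => ?_⟩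
    by_cases huL : u ∈ L
    · exact hg₂L u huL
    · rw [hg₂ u huL]
      refine hg₁T u (hu.imp_right fun hu => hu.resolve_left ?_)
      rintro rfl
      exact huL hvL

theorem gatherable_branchVerts [Finite N] (hsolid : Solid C) (hconn : C.Connected)
    (hfree : C.Free G)
    (hmov : ∀ (a : N) (K : (C.induce {a}ᶜ).ConnectedComponent),
      insert a (branchVerts K) ≠ Set.univ →
        Movable (C.induce (insert a (branchVerts K))) ⟨a, .inl rfl⟩ G X)
    (a : N) (K : (C.induce {a}ᶜ).ConnectedComponent) : Gatherable C G X a (branchVerts K) := by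
  induction hT : branchVerts K using WellFoundedLT.induction generalizing a K with
  | ind T ih =>
  subst hT
  intro g i hga
  have haK := notMem_branchVerts K
  let Q : Set N := insert a {q ∈ branchVerts K | C.Adj a q}
  have hQ : C.IsClique Q := SimpleGraph.isClique_insert.2 ⟨fun x hx y hy hxy =>
    hsolid.adj_of_mem_branchVerts hx.1 hy.1 hx.2 hy.2 hxy, fun q hq _ => hq.2⟩
  obtain ⟨j, hj⟩ := exists_subset_side_of_isClique (G := G) (Q := g '' Q) <| by
    rintro _ ⟨x, hx, rfl⟩ _ ⟨y, hy, rfl⟩ hxy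
    exact g.toHom.map_adj (hQ hx hy (ne_of_apply_ne g hxy))
  obtain ⟨g₁, hg₁, hg₁K⟩ := exists_copy_gather (M := branchVerts K) (Q := Q) (fun v hv hvQ => by
    obtain ⟨q, hq, haq, L, hvL, hLK⟩ := hsolid.exists_branchVerts_ssubset hconn hv
      fun hav => hvQ (.inr ⟨hv, hav⟩)
    exact ⟨q, .inr ⟨hq, haq⟩, branchVerts L, hLK.subset, hvL, ih _ hLK q L rfl⟩) g
    fun q hq => hj ⟨q, hq, rfl⟩
  obtain rfl | hij := eq_or_ne i j
  · exact ⟨g₁, hg₁, hg₁K⟩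
  have haj : g a ∈ side X j := hj ⟨a, .inl rfl, rfl⟩
  have haX : (g a).1.1 ∈ X := fst_mem_of_mem_side_of_mem_side hga haj hij
  rw [← hg₁ a haK] at haj haX
  have hg₁' : ∀ v ∈ insert a (branchVerts K), g₁ v ∈ side X j := by
    rintro v (rfl | hv)
    exacts [haj, hg₁K v hv]
  have hne : insert a (branchVerts K) ≠ Set.univ := fun h =>
    let ⟨k, _⟩ := exists_copy_of_forall_mem_side g₁ fun v => hg₁' v (h ▸ Set.mem_univ v)
    hfree ⟨k⟩
  obtain ⟨g₂, hg₂, hg₂K⟩ := exists_copy_switch (hmov a K hne) g₁ hg₁' haX i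
  exact ⟨g₂, fun v hv => (hg₂ v hv).trans (hg₁ v hv), hg₂K⟩

theorem free_double [Finite N] (hsolid : Solid C) (hconn : C.Connected) (hfree : C.Free G)
    (hmov : ∀ (a : N) (K : (C.induce {a}ᶜ).ConnectedComponent),
      insert a (branchVerts K) ≠ Set.univ →
        Movable (C.induce (insert a (branchVerts K))) ⟨a, .inl rfl⟩ G X) :
    C.Free (double G X) := by
  rintro ⟨g⟩
  obtain ⟨a⟩ := hconn.nonempty
  obtain ⟨g', -, hg'⟩ := exists_copy_gather (M := Set.univ) (Q := {a}) (fun v _ hva =>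
    let ⟨K, hvK⟩ := exists_mem_branchVerts (C := C) hva
    ⟨a, rfl, branchVerts K, Set.subset_univ _, hvK,
      gatherable_branchVerts hsolid hconn hfree hmov a K⟩) g
    (j := (g a).1.2) fun _ hq => hq ▸ .inr rfl
  obtain ⟨k, -⟩ := exists_copy_of_forall_mem_side g' fun v => hg' v trivial
  exact hfree ⟨k⟩

end Move

/-! ### Bases -/

section Base

variable {M N : Type*} {B : SimpleGraph M} {b : M} {C : SimpleGraph N} {a : N}

theorem exists_iso_graphPair [Finite M] (B : SimpleGraph M) (b : M) :
    ∃ (p : GraphPair) (φ : B ≃g p.graph), p.base = {φ b} := by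
  obtain ⟨m, ⟨e⟩⟩ := Finite.exists_equiv_fin M
  exact ⟨⟨m, B.map e, {e b}⟩, SimpleGraph.Iso.map e B, rfl⟩

theorem isBranch_induce (K : (C.induce {a}ᶜ).ConnectedComponent)
    (h : insert a (branchVerts K) ≠ Set.univ) :
    IsBranch C a ((⊤ : C.Subgraph).induce (insert a (branchVerts K))) := by
  refine ⟨fun htop => h (congrArg SimpleGraph.Subgraph.verts htop), .inl rfl, K, ?_⟩
  have hind : (((⊤ : C.Subgraph).induce (insert a (branchVerts K))).deleteVerts {a}).IsInduced :=
    fun _ hu _ hv huv =>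
      SimpleGraph.Subgraph.deleteVerts_adj.2 ⟨hu.1, hu.2, hv.1, hv.2, hu.1, hv.1, huv⟩
  rw [← hind.induce_top_verts]
  exact congrArg _ (Set.insert_sdiff_self_of_notMem (notMem_branchVerts K))

variable {𝒞 : Set FinGraph} {V : Type u} {G : SimpleGraph V} {X : Set V}

theorem movable_of_clFam_subset {F : Set GraphPair} (hX : clFam G F X ⊆ X) {p : GraphPair}
    (hp : p ∈ F) (φ : B ≃g p.graph) (hφ : p.base = {φ b}) : Movable B b G X := by
  intro e hb S hS
  let ψ : B ≃g e.toSubgraph.coe := e.isoToSubgraph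
  have hψ : ∀ v, (ψ v : V) = e v := fun _ => rfl
  have hiso : IsoPair {e b} e.toSubgraph p := by
    refine ⟨Set.singleton_subset_iff.2 (ψ b).2, ψ.symm.trans φ, fun x => ?_⟩
    obtain ⟨v, rfl⟩ := ψ.surjective x
    rw [RelIso.trans_apply, RelIso.symm_apply_apply, hφ, Set.mem_singleton_iff,
      Set.mem_singleton_iff, hψ]
    exact e.injective.eq_iff.trans φ.injective.eq_iff.symm
  have hcl : cl G {e b} e.toSubgraph ⊆ X := fun y hy =>
    hX (.inr ⟨{e b}, _, Set.singleton_subset_iff.2 hb, ⟨p, hp, hiso⟩, hy⟩)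
  obtain ⟨Y, hYX, hYe, hY⟩ := exists_freeOver_of_cl_subset hiso.finite_verts hiso.1 hcl
  obtain ⟨k, hk, hkS⟩ := hY.exists_avoiding hS
  have hbY : {e b} ∪ Y ⊆ X ∩ Set.range e := by
    refine Set.union_subset (Set.singleton_subset_iff.2 ⟨hb, b, rfl⟩) fun y hy => ⟨hYX hy, ?_⟩
    obtain ⟨v, hv⟩ := ψ.surjective ⟨y, hYe hy⟩
    exact ⟨v, congrArg Subtype.val hv⟩
  refine ⟨k.comp ψ.toCopy, hk (ψ b) (.inl (hψ b)), ?_⟩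
  rintro _ ⟨⟨v, rfl⟩, hvS⟩
  exact hbY (hkS ⟨⟨ψ v, rfl⟩, hvS⟩)

theorem movable_induce_branchVerts (hX : clFam G (inducedBranchPairs 𝒞) X ⊆ X) {C : FinGraph}
    (hC : C ∈ 𝒞) (a : Fin C.order) (K : (C.graph.induce {a}ᶜ).ConnectedComponent)
    (hK : insert a (branchVerts K) ≠ Set.univ) :
    Movable (C.graph.induce (insert a (branchVerts K))) ⟨a, .inl rfl⟩ G X := by
  let H := (⊤ : C.graph.Subgraph).induce (insert a (branchVerts K))
  have ha : a ∈ H.verts := .inl rfl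
  obtain ⟨p, φ, hφ⟩ := exists_iso_graphPair H.coe ⟨a, ha⟩
  have hiso : IsoPair {a} H p := by
    refine ⟨Set.singleton_subset_iff.2 ha, φ, fun x => ?_⟩
    rw [hφ, Set.mem_singleton_iff, Set.mem_singleton_iff, φ.injective.eq_iff, Subtype.ext_iff]
  rw [SimpleGraph.induce_eq_coe_induce_top]
  exact movable_of_clFam_subset hX
    ⟨C, hC, a, H, isBranch_induce K hK, fun _ hu _ hv huv => ⟨hu, hv, huv⟩, hiso⟩ φ hφ

theorem omits_double_of_clFam_subset (hconn : ∀ C ∈ 𝒞, C.graph.Connected)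
    (hsolid : ∀ C ∈ 𝒞, Solid C.graph) (hG : Omits 𝒞 G)
    (hX : clFam G (inducedBranchPairs 𝒞) X ⊆ X) : Omits 𝒞 (double G X) := fun C hC =>
  free_double (hsolid C hC) (hconn C hC) (hG C hC) (movable_induce_branchVerts hX hC)

theorem acl_subset_of_clFam_subset (hconn : ∀ C ∈ 𝒞, C.graph.Connected)
    (hsolid : ∀ C ∈ 𝒞, Solid C.graph) (hG : MemE 𝒞 G)
    (hX : clFam G (inducedBranchPairs 𝒞) X ⊆ X) : acl G X ⊆ X :=
  acl_subset_of_omits_double hG (omits_double_of_clFam_subset hconn hsolid hG.1.2 hX)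

theorem isBase_of_inducedBranchPairs_subset (hconn : ∀ C ∈ 𝒞, C.graph.Connected)
    (hsolid : ∀ C ∈ 𝒞, Solid C.graph) (hG : MemE 𝒞 G) {F : Set GraphPair}
    (hF : inducedBranchPairs 𝒞 ⊆ F) : IsBase G F := by
  refine fun X => ⟨fun h => ?_, fun h => ?_⟩
  · exact (subset_acl G X).antisymm
      (acl_subset_of_clFam_subset hconn hsolid hG ((clFam_mono G hF X).trans h.ge))
  · exact (subset_clFam G F X).antisymm (clFam_subset_of_acl_subset F h.ge)

theorem IsoPair.encard_base {A : Set V} {H : G.Subgraph} {p : GraphPair} (h : IsoPair A H p) :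
    p.base.encard = A.encard := by
  obtain ⟨hA, e, he⟩ := h
  have hbase : e ⁻¹' p.base = ((↑) : H.verts → V) ⁻¹' A := Set.ext fun x => (he x).symm
  rw [← Set.encard_preimage_of_bijective e.bijective, hbase,
    Set.encard_preimage_of_injective_subset_range Subtype.val_injective
      (Subtype.range_coe ▸ hA)]

theorem exists_eq_singleton_of_isoPair {A : Set V} {H : G.Subgraph} {p : GraphPair}
    (hp : p ∈ inducedBranchPairs 𝒞) (h : IsoPair A H p) : ∃ x, A = {x} := by
  obtain ⟨C, -, a, B, -, -, hB⟩ := hp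
  rw [← Set.encard_eq_one, ← h.encard_base, hB.encard_base, Set.encard_singleton]

theorem acl_eq_biUnion (hconn : ∀ C ∈ 𝒞, C.graph.Connected)
    (hsolid : ∀ C ∈ 𝒞, Solid C.graph) (hG : MemE 𝒞 G) (X : Set V) :
    acl G X = ⋃ a ∈ X, acl G {a} := by
  refine Set.Subset.antisymm ?_ (Set.iUnion₂_subset fun a ha =>
    acl_mono G (Set.singleton_subset_iff.2 ha))
  have hX : X ⊆ ⋃ a ∈ X, acl G {a} := fun x hx => Set.mem_biUnion hx (subset_acl G {x} rfl)
  refine (acl_mono G hX).trans (acl_subset_of_clFam_subset hconn hsolid hG ?_)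
  refine Set.union_subset subset_rfl ?_
  rintro y ⟨A, H, hA, ⟨p, hp, hiso⟩, hy⟩
  obtain ⟨x, rfl⟩ := exists_eq_singleton_of_isoPair hp hiso
  obtain ⟨a, haX, hxa⟩ := Set.mem_iUnion₂.1 (hA rfl)
  exact Set.mem_biUnion haX (cl_subset_of_acl_subset (acl_acl_subset G {a})
    hiso.finite_verts hiso.1 (Set.singleton_subset_iff.2 hxa) hy)

end Base

end ForbiddenSubgraphs

theorem proposition6_general (𝒞 : Set ForbiddenSubgraphs.FinGraph)
    (hconn : ∀ C ∈ 𝒞, C.graph.Connected)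
    (hsolid : ∀ C ∈ 𝒞, ForbiddenSubgraphs.Solid C.graph)
    {V : Type u} (G : SimpleGraph V) (hG : ForbiddenSubgraphs.MemE 𝒞 G) :
    ForbiddenSubgraphs.IsBase G (ForbiddenSubgraphs.branchPairs 𝒞) ∧
    ForbiddenSubgraphs.IsBase G (ForbiddenSubgraphs.inducedBranchPairs 𝒞) ∧
    ∀ X : Set V, ForbiddenSubgraphs.acl G X = ⋃ a ∈ X, ForbiddenSubgraphs.acl G {a} :=
  ⟨ForbiddenSubgraphs.isBase_of_inducedBranchPairs_subset hconn hsolid hG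
      fun _ ⟨C, hC, a, H, hH, _, hiso⟩ => ⟨C, hC, a, H, hH, hiso⟩,
    ForbiddenSubgraphs.isBase_of_inducedBranchPairs_subset hconn hsolid hG subset_rfl,
    ForbiddenSubgraphs.acl_eq_biUnion hconn hsolid hG⟩

theorem proposition6 (𝒞 : Set ForbiddenSubgraphs.FinGraph) (hfin : 𝒞.Finite)
    (hconn : ∀ C ∈ 𝒞, C.graph.Connected)
    (hsolid : ∀ C ∈ 𝒞, ForbiddenSubgraphs.Solid C.graph)
    {V : Type u} (G : SimpleGraph V) (hG : ForbiddenSubgraphs.MemE 𝒞 G)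
    (hsat : ForbiddenSubgraphs.Saturated 𝒞 G) :
    ForbiddenSubgraphs.IsBase G (ForbiddenSubgraphs.branchPairs 𝒞) ∧
    ForbiddenSubgraphs.IsBase G (ForbiddenSubgraphs.inducedBranchPairs 𝒞) ∧
    ∀ X : Set V, ForbiddenSubgraphs.acl G X = ⋃ a ∈ X, ForbiddenSubgraphs.acl G {a} :=
  proposition6_general 𝒞 hconn hsolid G hG
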